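/- Let $G=(A\cup B,E)$ be a finite bipartite graph in which every vertex $v$ has an integral capacity $\mathsf{cap}(v)\ge 1$ and a strict linear preference order on its neighbors. A matching is a set $M\subseteq E$ such that $M(v)=\{u:(u,v)\in M\}$ satisfies $|M(v)|\le \mathsf{cap}(v)$ for every vertex $v$; it is perfect if $|M(v)|=\mathsf{cap}(v)$ for every $v$. For a vertex $v$ and neighbors $u,u'$ let $\mathsf{vote}_v(u,u')$ be $1$ if $v$ prefers $u$ to $u'$, $-1$ if $v$ prefers $u'$ to $u$, and $0$ if $u=u'$. For sets $S,T$ of neighbors of $v$ let $$\mathsf{vote}_v(S,T)=\min_{\psi}\sum_{u\in S\setminus T}\mathsf{vote}_v(u,\psi(u)),$$ where $\psi$ ranges over the bijections $S\setminus T\to T\setminus S$ (if the two differences have different sizes, the smaller one is first padded with dummy vertices that $v$ likes less than every non-dummy vertex). Let $\Delta(M,N)=\sum_{v\in A\cup B}\mathsf{vote}_v(M(v),N(v))$. A perfect matching $M$ is a popular perfect matching if $\Delta(M,N)\ge 0$ for all perfect matchings $N$. The cloned instance $G'=(A'\cup B',E')$ has vertices $A'=\{a_i: a\in A,\ 1\le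 i\le \mathsf{cap}(a)\}$ and $B'=\{b_j: b\in B,\ 1\le j\le \mathsf{cap}(b)\}$, all of capacity $1$, and edges $E'=\{(a_i,b_j):(a,b)\in E\}$; each clone $v_i$ has the preference order of $v$ in which every neighbor $u$ is replaced by its clones in the order $u_1\succ\cdots\succ u_{\mathsf{cap}(u)}$. A realization $M'$ of a matching $M$ in $G$ consists of one edge $(a_i,b_j)\in E'$ for each $(a,b)\in M$, the indices being chosen so that no clone is used twice. Let $G'_{M'}=(A'\cup B',E'_{M'})$ be the subgraph of $G'$, with the inherited preferences and capacities $1$, whose edge set is $$E'_{M'}=M'\cup\{(a_i,b_j):(a,b)\in E\setminus M,\ 1\le i\le \mathsf{cap}(a),\ 1\le j\le \mathsf{cap}(b)\}.$$ Let $M$ be any perfect matching in $G$. Then $M$ is a popular perfect matching in $G$ if and only if there is a realization $M'$ of $M$ such that $M'$ is a popular perfect matching in the one-to-one instance $G'_{M'}$. -/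

import Mathlib

/-- A many-to-many matching instance on a bipartite graph with vertex classes `A` and `B`:
a set of edges, capacities at least 1, and for every vertex a strict linear order on its
neighbours (`prefA a b c` reads: `a` prefers `b` to `c`). Only the restriction of a preference
relation to the neighbours of the vertex is meaningful. -/
structure MatchingInstance (A : Type*) (B : Type*) where
  edges : Finset (A × B)
  capA : A → ℕ
  capB : B → ℕ
  one_le_capA : ∀ a, 1 ≤ capA a
  one_le_capB : ∀ b, 1 ≤ capB b
  prefA : A → B → B → Prop
  prefB : B → A → A → Prop
  prefA_irrefl : ∀ a b, (a, b) ∈ edges → ¬ prefA a b b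
  prefA_trans : ∀ a b c d, (a, b) ∈ edges → (a, c) ∈ edges → (a, d) ∈ edges →
    prefA a b c → prefA a c d → prefA a b d
  prefA_total : ∀ a b c, (a, b) ∈ edges → (a, c) ∈ edges → b ≠ c → prefA a b c ∨ prefA a c b
  prefB_irrefl : ∀ b a, (a, b) ∈ edges → ¬ prefB b a a
  prefB_trans : ∀ b a c d, (a, b) ∈ edges → (c, b) ∈ edges → (d, b) ∈ edges →
    prefB b a c → prefB b c d → prefB b a d
  prefB_total : ∀ b a c, (a, b) ∈ edges → (c, b) ∈ edges → a ≠ c → prefB b a c ∨ prefB b c a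

namespace MatchingInstance

section Votes

variable {V : Type*}

open scoped Classical in
/-- The vote for `u` versus `u'` of a voter with preference relation `pref`. The value `none` is
a dummy vertex, less preferred than every non-dummy vertex. -/
noncomputable def vote (pref : V → V → Prop) : Option V → Option V → ℤ
  | some u, some u' => if pref u u' then 1 else if pref u' u then -1 else 0
  | some _, none => 1
  | none, some _ => -1
  | none, none => 0

open scoped Classical in
/-- The set `S \ T`, padded with as many dummies as it has fewer elements than `T \ S`. -/
abbrev Padded (S T : Finset V) : Type _ :=
  {u : V // u ∈ S \ T} ⊕ Fin ((T \ S).card - (S \ T).card)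

/-- The vertex (or `none` for a dummy) that an element of the padded set stands for. -/
def Padded.toOption {S T : Finset V} (x : Padded S T) : Option V :=
  Sum.elim (fun u => some u.1) (fun _ => none) x

theorem nonempty_padded_equiv (S T : Finset V) : Nonempty (Padded S T ≃ Padded T S) := by
  classical
  rw [← Fintype.card_eq]
  simp only [Fintype.card_sum, Fintype.card_fin, Fintype.card_coe]
  omega

open scoped Classical in
/-- The vote for the set `S` versus the set `T` of a voter with preference relation `pref`: the
minimum, over all bijections from (padded) `S \ T` to (padded) `T \ S`, of the number of wins
minus the number of losses. -/
noncomputable def setVote (pref : V → V → Prop) (S T : Finset V) : ℤ :=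
  (Finset.univ : Finset (Padded S T ≃ Padded T S)).inf'
    (Finset.univ_nonempty_iff.mpr (nonempty_padded_equiv S T))
    (fun ψ => ∑ x : Padded S T, vote pref x.toOption (ψ x).toOption)

end Votes

section Matchings

variable {A B : Type*}

open scoped Classical in
/-- `M(a)`, the set of partners of `a : A` in `M`. -/
noncomputable def partnersA (M : Finset (A × B)) (a : A) : Finset B :=
  (M.filter (fun e => e.1 = a)).image Prod.snd

open scoped Classical in
/-- `M(b)`, the set of partners of `b : B` in `M`. -/
noncomputable def partnersB (M : Finset (A × B)) (b : B) : Finset A :=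
  (M.filter (fun e => e.2 = b)).image Prod.fst

/-- A matching: a set of edges in which no vertex exceeds its capacity. -/
def IsMatching (G : MatchingInstance A B) (M : Finset (A × B)) : Prop :=
  M ⊆ G.edges ∧ (∀ a, (partnersA M a).card ≤ G.capA a) ∧ (∀ b, (partnersB M b).card ≤ G.capB b)

/-- A perfect matching: a matching that matches every vertex up to its capacity. -/
def IsPerfectMatching (G : MatchingInstance A B) (M : Finset (A × B)) : Prop :=
  G.IsMatching M ∧
    (∀ a, (partnersA M a).card = G.capA a) ∧ (∀ b, (partnersB M b).card = G.capB b)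

/-- `Δ(M, N)`, the sum over all vertices of their votes for `M` versus `N`. -/
noncomputable def delta [Fintype A] [Fintype B] (G : MatchingInstance A B)
    (M N : Finset (A × B)) : ℤ :=
  ∑ a : A, setVote (G.prefA a) (partnersA M a) (partnersA N a) +
    ∑ b : B, setVote (G.prefB b) (partnersB M b) (partnersB N b)

/-- A popular perfect matching: a perfect matching that loses to no perfect matching. -/
def IsPopularPerfectMatching [Fintype A] [Fintype B] (G : MatchingInstance A B)
    (M : Finset (A × B)) : Prop :=
  G.IsPerfectMatching M ∧ ∀ N, G.IsPerfectMatching N → 0 ≤ G.delta M N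

open scoped Classical in
/-- The instance obtained by keeping only the edges in `F`. -/
noncomputable def restrict (G : MatchingInstance A B) (F : Finset (A × B)) :
    MatchingInstance A B where
  edges := G.edges.filter (fun e => e ∈ F)
  capA := G.capA
  capB := G.capB
  one_le_capA := G.one_le_capA
  one_le_capB := G.one_le_capB
  prefA := G.prefA
  prefB := G.prefB
  prefA_irrefl a b h := G.prefA_irrefl a b (Finset.mem_filter.mp h).1
  prefA_trans a b c d h₁ h₂ h₃ := G.prefA_trans a b c d (Finset.mem_filter.mp h₁).1
    (Finset.mem_filter.mp h₂).1 (Finset.mem_filter.mp h₃).1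
  prefA_total a b c h₁ h₂ := G.prefA_total a b c (Finset.mem_filter.mp h₁).1
    (Finset.mem_filter.mp h₂).1
  prefB_irrefl b a h := G.prefB_irrefl b a (Finset.mem_filter.mp h).1
  prefB_trans b a c d h₁ h₂ h₃ := G.prefB_trans b a c d (Finset.mem_filter.mp h₁).1
    (Finset.mem_filter.mp h₂).1 (Finset.mem_filter.mp h₃).1
  prefB_total b a c h₁ h₂ := G.prefB_total b a c (Finset.mem_filter.mp h₁).1
    (Finset.mem_filter.mp h₂).1

end Matchings

section Cloning

variable {A B : Type*}

/-- `A'`: every `a : A` is replaced by `capA a` clones. -/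
abbrev CloneA (G : MatchingInstance A B) : Type _ := Σ a : A, Fin (G.capA a)

/-- `B'`: every `b : B` is replaced by `capB b` clones. -/
abbrev CloneB (G : MatchingInstance A B) : Type _ := Σ b : B, Fin (G.capB b)

/-- The preference relation `pref` with every vertex replaced by its clones, in the order of
their indices. -/
def clonePref {V : Type*} {cap : V → ℕ} (pref : V → V → Prop) (x y : Σ v : V, Fin (cap v)) :
    Prop :=
  pref x.1 y.1 ∨ (x.1 = y.1 ∧ (x.2 : ℕ) < (y.2 : ℕ))

theorem clonePref_irrefl {V : Type*} {cap : V → ℕ} {pref : V → V → Prop}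
    (x : Σ v : V, Fin (cap v)) (h : ¬ pref x.1 x.1) : ¬ clonePref pref x x := by
  rintro (h' | ⟨_, h'⟩)
  · exact h h'
  · exact lt_irrefl _ h'

theorem clonePref_trans {V : Type*} {cap : V → ℕ} {pref : V → V → Prop}
    (x y z : Σ v : V, Fin (cap v))
    (h : pref x.1 y.1 → pref y.1 z.1 → pref x.1 z.1)
    (hxy : clonePref pref x y) (hyz : clonePref pref y z) : clonePref pref x z := by
  rcases hxy with hxy | ⟨e, hxy⟩ <;> rcases hyz with hyz | ⟨e', hyz⟩
  · exact Or.inl (h hxy hyz)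
  · exact Or.inl (e' ▸ hxy)
  · exact Or.inl (e.symm ▸ hyz)
  · exact Or.inr ⟨e.trans e', hxy.trans hyz⟩

theorem clonePref_total {V : Type*} {cap : V → ℕ} {pref : V → V → Prop}
    (x y : Σ v : V, Fin (cap v))
    (h : x.1 ≠ y.1 → pref x.1 y.1 ∨ pref y.1 x.1) (hxy : x ≠ y) :
    clonePref pref x y ∨ clonePref pref y x := by
  by_cases e : x.1 = y.1
  · obtain ⟨v, i⟩ := x
    obtain ⟨w, j⟩ := y
    obtain rfl : v = w := e
    have hij : (i : ℕ) ≠ (j : ℕ) := fun hh => hxy (by rw [Fin.ext hh])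
    rcases lt_or_gt_of_ne hij with hh | hh
    · exact Or.inl (Or.inr ⟨rfl, hh⟩)
    · exact Or.inr (Or.inr ⟨rfl, hh⟩)
  · exact (h e).imp Or.inl Or.inl

variable [Fintype A] [Fintype B]

open scoped Classical in
/-- The one-to-one instance `G'` obtained from `G` by cloning. -/
noncomputable def cloned (G : MatchingInstance A B) : MatchingInstance G.CloneA G.CloneB where
  edges := Finset.univ.filter (fun e => (e.1.1, e.2.1) ∈ G.edges)
  capA _ := 1
  capB _ := 1
  one_le_capA _ := le_rfl
  one_le_capB _ := le_rfl
  prefA x := clonePref (G.prefA x.1)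
  prefB y := clonePref (G.prefB y.1)
  prefA_irrefl _ b h := clonePref_irrefl b (G.prefA_irrefl _ _ (Finset.mem_filter.mp h).2)
  prefA_trans _ b c d h₁ h₂ h₃ := clonePref_trans b c d
    (G.prefA_trans _ _ _ _ (Finset.mem_filter.mp h₁).2 (Finset.mem_filter.mp h₂).2
      (Finset.mem_filter.mp h₃).2)
  prefA_total _ b c h₁ h₂ := clonePref_total b c
    (G.prefA_total _ _ _ (Finset.mem_filter.mp h₁).2 (Finset.mem_filter.mp h₂).2)
  prefB_irrefl _ a h := clonePref_irrefl a (G.prefB_irrefl _ _ (Finset.mem_filter.mp h).2)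
  prefB_trans _ a c d h₁ h₂ h₃ := clonePref_trans a c d
    (G.prefB_trans _ _ _ _ (Finset.mem_filter.mp h₁).2 (Finset.mem_filter.mp h₂).2
      (Finset.mem_filter.mp h₃).2)
  prefB_total _ a c h₁ h₂ := clonePref_total a c
    (G.prefB_total _ _ _ (Finset.mem_filter.mp h₁).2 (Finset.mem_filter.mp h₂).2)

open scoped Classical in
/-- `M'` is a one-to-one realization of `M`: every edge `(a, b)` of `M` is assigned an index `i` of
a clone of `a` and an index `j` of a clone of `b`, no clone being used twice, and `M'` consists of
the edges `(a_i, b_j)`. -/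
def IsRealization (G : MatchingInstance A B) (M : Finset (A × B))
    (M' : Finset (G.CloneA × G.CloneB)) : Prop :=
  ∃ (i : ∀ e : {e : A × B // e ∈ M}, Fin (G.capA e.1.1))
    (j : ∀ e : {e : A × B // e ∈ M}, Fin (G.capB e.1.2)),
    Function.Injective (fun e => (⟨e.1.1, i e⟩ : G.CloneA)) ∧
    Function.Injective (fun e => (⟨e.1.2, j e⟩ : G.CloneB)) ∧
    M' = Finset.univ.image
      (fun e => ((⟨e.1.1, i e⟩ : G.CloneA), (⟨e.1.2, j e⟩ : G.CloneB)))

open scoped Classical in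
/-- The edge set `E'_{M'}`: the edges of `M'` and all copies `(a_i, b_j)` of the edges `(a, b)` of
`G` that are not in `M`. -/
noncomputable def realizationEdges (G : MatchingInstance A B) (M : Finset (A × B))
    (M' : Finset (G.CloneA × G.CloneB)) : Finset (G.CloneA × G.CloneB) :=
  M' ∪ Finset.univ.filter (fun e => (e.1.1, e.2.1) ∈ G.edges \ M)

/-- The one-to-one instance `G'_{M'}`: the subgraph of `G'` with edge set `E'_{M'}`. -/
noncomputable def realizationInstance (G : MatchingInstance A B) (M : Finset (A × B))
    (M' : Finset (G.CloneA × G.CloneB)) : MatchingInstance G.CloneA G.CloneB :=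
  G.cloned.restrict (G.realizationEdges M M')

/-- For a realization of a set of edges of `G`, no edge of `E'_{M'}` is lost in `G'_{M'}`. -/
theorem realizationInstance_edges (G : MatchingInstance A B) {M : Finset (A × B)}
    {M' : Finset (G.CloneA × G.CloneB)} (hM : M ⊆ G.edges) (h : G.IsRealization M M') :
    (G.realizationInstance M M').edges = G.realizationEdges M M' := by
  classical
  obtain ⟨i, j, -, -, rfl⟩ := h
  ext e
  simp only [realizationInstance, restrict, cloned, realizationEdges, Finset.mem_filter,
    Finset.mem_univ, true_and, Finset.mem_union, Finset.mem_image, Finset.mem_sdiff,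
    and_iff_right_iff_imp]
  rintro (⟨f, rfl⟩ | h)
  · exact hM f.2
  · exact h.1

end Cloning

end MatchingInstance

/-! Comparing a perfect matching `M` with a perfect matching `N` amounts to permuting the edges of
`M`. Optimal pairings at the vertices of `A` assemble into a bijection from `M` to `N` that keeps
the `A`-end, those in `B` into one that keeps the `B`-end. Composing the first with the inverse of
the second gives a permutation `σ` of `M` for which every `e ≠ σ e` is joined, from its `A`-end to
the `B`-end of `σ e`, by an edge outside `M`. The total vote is a sum of terms depending on `e` and
`σ e` only.

Conversely, such a `σ` yields a perfect matching if its joining edges are pairwise distinct.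
Repeated edges are the obstacle: they cannot occur in a matching of `G`, while in the cloned graph
they become different copies. A parity argument (`sum_weight_nonneg_of_injective`) removes it: in a
negative `σ` of smallest support, exchanging two images at a repeated edge gives another such
permutation; both must be cycles of the same length, yet they differ by a transposition. Hence
popularity means that no admissible permutation is negative (`isPopularPerfectMatching_iff`).

This criterion is the same for `M` and for any realization `M'`: `E'_{M'}` contains every copy of an
edge outside `M`, but of the edges of `M` only the copies in `M'`, and clone indices never decide a
vote. So every realization works, and one exists because `M` is perfect. -/

namespace MatchingInstance

/-! ### Set votes as minima over bijections fixing the common elements -/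

section SetVote

variable {U : Type*}

open scoped Classical in
/-- The vote of `u` versus `u'`, with value `0` at `u = u'` whatever the relation. -/
noncomputable def voteOrZero (pref : U → U → Prop) (u u' : U) : ℤ :=
  if u' = u then 0 else vote pref (some u) (some u')

theorem voteOrZero_self (pref : U → U → Prop) (u : U) : voteOrZero pref u u = 0 := by
  simp [voteOrZero]

theorem sum_voteOrZero_eq_sum_sdiff [DecidableEq U] (pref : U → U → Prop) {S T : Finset U}
    {t : U → U} (hfix : ∀ u ∈ S, u ∈ T → t u = u) (hne : ∀ u ∈ S, u ∉ T → t u ≠ u) :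
    ∑ u ∈ S, voteOrZero pref u (t u) =
      ∑ u : {u : U // u ∈ S \ T}, vote pref (some u.1) (some (t u.1)) := by
  rw [Finset.sum_coe_sort (S \ T) (fun u => vote pref (some u) (some (t u)))]
  symm
  calc _ = ∑ u ∈ S \ T, voteOrZero pref u (t u) := Finset.sum_congr rfl fun u hu => by
        rw [Finset.mem_sdiff] at hu
        simp [voteOrZero, hne u hu.1 hu.2]
    _ = _ := Finset.sum_subset Finset.sdiff_subset fun u hu hu' => by
        have : u ∈ T := by_contra fun h => hu' (Finset.mem_sdiff.mpr ⟨hu, h⟩)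
        rw [hfix u hu this, voteOrZero_self]

/-- Restricted to `S \ T`, such a `t` is one of the bijections competing in the minimum; equal
cardinalities leave no dummies. -/
theorem setVote_le_sum (pref : U → U → Prop) {S T : Finset U} {t : U → U}
    (ht : Set.BijOn t S T) (hfix : ∀ u ∈ S, u ∈ T → t u = u) :
    setVote pref S T ≤ ∑ u ∈ S, voteOrZero pref u (t u) := by
  classical
  have hcard : S.card = T.card := by
    have := ht.image_eq
    rw [← Finset.coe_image, Finset.coe_inj] at this
    rw [← this, Finset.card_image_of_injOn ht.injOn]
  have hsd : (T \ S).card = (S \ T).card := by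
    have h1 := Finset.card_sdiff_add_card_inter S T
    have h2 := Finset.card_sdiff_add_card_inter T S
    rw [Finset.inter_comm] at h2
    omega
  have hne : ∀ u ∈ S, u ∉ T → t u ≠ u := fun u hu hu' h =>
    hu' (h ▸ Finset.mem_coe.mp (ht.mapsTo (Finset.mem_coe.mpr hu)))
  have hmaps : ∀ u ∈ S \ T, t u ∈ T \ S := by
    intro u hu
    rw [Finset.mem_sdiff] at hu ⊢
    refine ⟨ht.mapsTo (Finset.mem_coe.mpr hu.1), fun h => hne u hu.1 hu.2 ?_⟩
    have hT : t u ∈ T := ht.mapsTo (Finset.mem_coe.mpr hu.1)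
    exact ht.injOn h hu.1 (hfix _ h hT)
  let φ : {u : U // u ∈ S \ T} → {u : U // u ∈ T \ S} := fun u => ⟨t u.1, hmaps u.1 u.2⟩
  have hφ : Function.Bijective φ := by
    rw [Fintype.bijective_iff_injective_and_card]
    refine ⟨fun x y h => Subtype.ext (ht.injOn (Finset.mem_sdiff.mp x.2).1
      (Finset.mem_sdiff.mp y.2).1 (congrArg Subtype.val h)), ?_⟩
    simpa only [Fintype.card_coe] using hsd.symm
  rw [sum_voteOrZero_eq_sum_sdiff pref hfix hne]
  have key : ∀ ψ : Padded S T ≃ Padded T S, setVote pref S T ≤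
      ∑ x : Padded S T, vote pref x.toOption (ψ x).toOption := fun ψ =>
    Finset.inf'_le (fun ψ : Padded S T ≃ Padded T S =>
      ∑ x : Padded S T, vote pref x.toOption (ψ x).toOption) (Finset.mem_univ ψ)
  refine (key ((Equiv.ofBijective φ hφ).sumCongr (finCongr (by omega)))).trans_eq ?_
  have : IsEmpty (Fin ((T \ S).card - (S \ T).card)) := by
    rw [hsd, Nat.sub_self]; infer_instance
  rw [Fintype.sum_sum_type]
  simp [Padded.toOption, φ]

/-- A minimizing bijection, extended by the identity, attains the bound of `setVote_le_sum`. -/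
theorem exists_setVote_eq_sum (pref : U → U → Prop) {S T : Finset U} (hcard : S.card = T.card) :
    ∃ t : U → U, Set.BijOn t S T ∧ (∀ u ∈ S, u ∈ T → t u = u) ∧
      setVote pref S T = ∑ u ∈ S, voteOrZero pref u (t u) := by
  classical
  have hsd : (T \ S).card = (S \ T).card := by
    have h1 := Finset.card_sdiff_add_card_inter S T
    have h2 := Finset.card_sdiff_add_card_inter T S
    rw [Finset.inter_comm] at h2
    omega
  have hE : IsEmpty (Fin ((T \ S).card - (S \ T).card)) := by
    rw [hsd, Nat.sub_self]; infer_instance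
  have hE' : IsEmpty (Fin ((S \ T).card - (T \ S).card)) := by
    rw [hsd, Nat.sub_self]; infer_instance
  obtain ⟨ψ, -, hψ⟩ := Finset.exists_mem_eq_inf'
    (Finset.univ_nonempty_iff.mpr (nonempty_padded_equiv S T))
    (fun ψ : Padded S T ≃ Padded T S =>
      ∑ x : Padded S T, vote pref x.toOption (ψ x).toOption)
  let φ : {u : U // u ∈ S \ T} ≃ {u : U // u ∈ T \ S} :=
    ((Equiv.sumEmpty _ _).symm.trans ψ).trans (Equiv.sumEmpty _ _)
  have hφ : ∀ u, ψ (Sum.inl u) = Sum.inl (φ u) := fun u =>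
    ((Equiv.sumEmpty _ _).symm_apply_apply (ψ (Sum.inl u))).symm
  let t : U → U := fun u => if h : u ∈ S \ T then (φ ⟨u, h⟩).1 else u
  have ht : ∀ u (h : u ∈ S \ T), t u = (φ ⟨u, h⟩).1 := fun u h => dif_pos h
  have ht' : ∀ u, u ∉ S \ T → t u = u := fun u h => dif_neg h
  have hmem : ∀ u ∈ S \ T, t u ∈ T \ S := fun u h => by rw [ht u h]; exact (φ ⟨u, h⟩).2
  have hfix : ∀ u ∈ S, u ∈ T → t u = u := fun u _ hT =>
    ht' u fun h => (Finset.mem_sdiff.mp h).2 hT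
  have hmaps : Set.MapsTo t S T := fun u hu => by
    by_cases hT : u ∈ T
    · rw [hfix u hu hT]; exact hT
    · exact (Finset.mem_sdiff.mp (hmem u (Finset.mem_sdiff.mpr ⟨hu, hT⟩))).1
  have hinj : Set.InjOn t S := fun u hu v hv h => by
    by_cases hu' : u ∈ S \ T <;> by_cases hv' : v ∈ S \ T
    · rw [ht u hu', ht v hv'] at h
      exact congrArg Subtype.val (φ.injective (Subtype.ext h))
    · have := hmem u hu'
      rw [h, ht' v hv'] at this
      exact absurd hv (Finset.mem_sdiff.mp this).2
    · have := hmem v hv'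
      rw [← h, ht' u hu'] at this
      exact absurd hu (Finset.mem_sdiff.mp this).2
    · rwa [ht' u hu', ht' v hv'] at h
  refine ⟨t, ⟨hmaps, hinj, Finset.surjOn_of_injOn_of_card_le t hmaps hinj hcard.ge⟩, hfix, ?_⟩
  rw [sum_voteOrZero_eq_sum_sdiff pref hfix fun u hu hu' h =>
    hu' (h ▸ Finset.mem_coe.mp (hmaps (Finset.mem_coe.mpr hu)))]
  refine hψ.trans ?_
  rw [Fintype.sum_sum_type]
  simp only [Finset.univ_eq_empty, Finset.sum_empty, add_zero]
  refine Finset.sum_congr rfl fun u _ => ?_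
  rw [hφ, ht u.1 u.2]
  rfl

end SetVote

/-! ### From pairings at single vertices to bijections between edge sets -/

section Fibers

variable {X V U : Type*}

open scoped Classical in
/-- The partners of `v` in `M`, where `r` splits an edge into a voter and its partner. -/
noncomputable def partnersVia (r : X ≃ V × U) (M : Finset X) (v : V) : Finset U :=
  (M.filter (fun e => (r e).1 = v)).image (fun e => (r e).2)

theorem mem_partnersVia {r : X ≃ V × U} {M : Finset X} {v : V} {u : U} :
    u ∈ partnersVia r M v ↔ r.symm (v, u) ∈ M := by
  classical
  simp only [partnersVia, Finset.mem_image, Finset.mem_filter]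
  constructor
  · rintro ⟨e, ⟨he, rfl⟩, rfl⟩
    simpa using he
  · exact fun h => ⟨_, ⟨h, by simp⟩, by simp⟩

theorem sum_partnersVia [Fintype V] (r : X ≃ V × U) (M : Finset X) (g : V → U → ℤ) :
    ∑ v, ∑ u ∈ partnersVia r M v, g v u = ∑ e ∈ M, g (r e).1 (r e).2 := by
  classical
  rw [← Finset.sum_fiberwise M (fun e => (r e).1) (fun e => g (r e).1 (r e).2)]
  refine Finset.sum_congr rfl fun v _ => ?_
  have : partnersVia r M v = (M.filter (fun e => (r e).1 = v)).image (fun e => (r e).2) := by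
    ext; simp [partnersVia]
  rw [this, Finset.sum_image]
  · refine Finset.sum_congr rfl fun e he => ?_
    rw [(Finset.mem_filter.mp he).2]
  · intro e he f hf h
    exact r.injective (Prod.ext
      ((Finset.mem_filter.mp he).2.trans (Finset.mem_filter.mp hf).2.symm) h)

/-- A bijection of edges that preserves the voter splits into one bijection per voter. Taking `r` to
be the identity or the swap treats both sides of the graph at once. -/
theorem bijOn_partnersVia {r : X ≃ V × U} {M N : Finset X} {T : X → X}
    (hT : Set.BijOn T M N) (hr : ∀ e ∈ M, (r (T e)).1 = (r e).1) (v : V) :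
    Set.BijOn (fun u => (r (T (r.symm (v, u)))).2) (partnersVia r M v) (partnersVia r N v) := by
  have hsymm : ∀ u ∈ partnersVia r M v,
      r.symm (v, (r (T (r.symm (v, u)))).2) = T (r.symm (v, u)) := fun u hu => by
    rw [Equiv.symm_apply_eq]
    refine Prod.ext ?_ rfl
    simpa using (hr _ (mem_partnersVia.mp hu)).symm
  refine ⟨fun u hu => ?_, fun u hu u' hu' h => ?_, fun u hu => ?_⟩
  · rw [Finset.mem_coe, mem_partnersVia, hsymm u hu]
    exact hT.mapsTo (mem_partnersVia.mp hu)
  · have h' : T (r.symm (v, u)) = T (r.symm (v, u')) := by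
      rw [← hsymm u hu, ← hsymm u' hu']
      exact congrArg (fun z => r.symm (v, z)) h
    have := hT.injOn (mem_partnersVia.mp hu) (mem_partnersVia.mp hu') h'
    simpa using this
  · obtain ⟨e, he, h⟩ := hT.surjOn (mem_partnersVia.mp hu)
    have hv : (r e).1 = v := by rw [← hr e he, h]; simp
    have he' : r.symm (v, (r e).2) = e := by rw [← hv]; simp
    refine ⟨(r e).2, mem_partnersVia.mpr (he'.symm ▸ he), ?_⟩
    simp [he', h]

theorem card_partnersVia_eq {r : X ≃ V × U} {M N : Finset X} {T : X → X}
    (hT : Set.BijOn T M N) (hr : ∀ e ∈ M, (r (T e)).1 = (r e).1) (v : V) :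
    (partnersVia r N v).card = (partnersVia r M v).card := by
  classical
  have h := bijOn_partnersVia hT hr v
  have := h.image_eq
  rw [← Finset.coe_image, Finset.coe_inj] at this
  rw [← this, Finset.card_image_of_injOn h.injOn]

theorem sum_setVote_le [Fintype V] {r : X ≃ V × U} {M N : Finset X} {T : X → X}
    (hT : Set.BijOn T M N) (hr : ∀ e ∈ M, (r (T e)).1 = (r e).1)
    (hfix : ∀ e ∈ M, e ∈ N → T e = e) (pref : V → U → U → Prop) :
    ∑ v, setVote (pref v) (partnersVia r M v) (partnersVia r N v) ≤
      ∑ e ∈ M, voteOrZero (pref (r e).1) (r e).2 (r (T e)).2 := by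
  calc _ ≤ ∑ v, ∑ u ∈ partnersVia r M v,
          voteOrZero (pref v) u (r (T (r.symm (v, u)))).2 := by
        refine Finset.sum_le_sum fun v _ => setVote_le_sum _ (bijOn_partnersVia hT hr v) ?_
        intro u hu hu'
        rw [hfix _ (mem_partnersVia.mp hu) (mem_partnersVia.mp hu')]
        simp
    _ = _ := by
        rw [sum_partnersVia r M fun v u => voteOrZero (pref v) u (r (T (r.symm (v, u)))).2]
        simp

theorem exists_sum_setVote_eq [Fintype V] (r : X ≃ V × U) {M N : Finset X}
    (hcard : ∀ v, (partnersVia r M v).card = (partnersVia r N v).card)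
    (pref : V → U → U → Prop) :
    ∃ T : X → X, Set.BijOn T M N ∧ (∀ e ∈ M, (r (T e)).1 = (r e).1) ∧
      (∀ e ∈ M, e ∈ N → T e = e) ∧
      ∑ v, setVote (pref v) (partnersVia r M v) (partnersVia r N v) =
        ∑ e ∈ M, voteOrZero (pref (r e).1) (r e).2 (r (T e)).2 := by
  choose t ht hfix hsum using fun v => exists_setVote_eq_sum (pref v) (hcard v)
  have hmem : ∀ {L : Finset X} {e : X}, e ∈ L ↔ (r e).2 ∈ partnersVia r L (r e).1 := by
    intro L e
    rw [mem_partnersVia]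
    simp
  refine ⟨fun e => r.symm ((r e).1, t (r e).1 (r e).2), ⟨?_, ?_, ?_⟩, ?_, ?_, ?_⟩
  · intro e he
    exact mem_partnersVia.mp ((ht (r e).1).mapsTo (hmem.mp he))
  · intro e he f hf h
    have h := r.symm.injective h
    rw [Prod.mk.injEq] at h
    refine r.injective (Prod.ext h.1 ((ht (r e).1).injOn (hmem.mp he) ?_ (h.2.trans ?_)))
    · rw [h.1]; exact hmem.mp hf
    · rw [h.1]
  · intro f hf
    obtain ⟨u, hu, h⟩ := (ht (r f).1).surjOn (hmem.mp hf)
    exact ⟨r.symm ((r f).1, u), mem_partnersVia.mp hu, by simp [h]⟩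
  · intro e _
    simp
  · intro e he he'
    dsimp only
    rw [hfix _ _ (hmem.mp he) (hmem.mp he')]
    simp
  · rw [Finset.sum_congr rfl fun v _ => hsum v,
      sum_partnersVia r M fun v u => voteOrZero (pref v) u (t v u)]
    simp

end Fibers

end MatchingInstance

namespace MatchingInstance

/-! ### Permutations of negative weight and the parity argument -/

section Permutations

variable {I : Type*} [Fintype I]

theorem sum_weight_mul_of_disjoint {w : I → I → ℤ} (hw : ∀ e, w e e = 0) {f g : Equiv.Perm I}
    (h : f.Disjoint g) :
    ∑ e, w e ((f * g) e) = ∑ e, w e (f e) + ∑ e, w e (g e) := by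
  rw [← Finset.sum_add_distrib]
  refine Finset.sum_congr rfl fun e _ => ?_
  rcases h e with he | he
  · rw [h.commute.eq, Equiv.Perm.mul_apply, he, hw, zero_add]
  · rw [Equiv.Perm.mul_apply, he, hw, add_zero]

/-- If the admissible permutation `σ` has negative weight and no admissible permutation of
smaller support has, then `σ` is a cycle. -/
theorem isCycle_of_minimal_weight [DecidableEq I] {R : I → I → Prop} (hR : ∀ e, R e e)
    {w : I → I → ℤ} (hw : ∀ e, w e e = 0) {σ : Equiv.Perm I} (hσ : ∀ e, R e (σ e))
    (hneg : ∑ e, w e (σ e) < 0)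
    (hmin : ∀ τ : Equiv.Perm I, (∀ e, R e (τ e)) → ∑ e, w e (τ e) < 0 →
      σ.support.card ≤ τ.support.card) : σ.IsCycle := by
  have hne : σ ≠ 1 := by
    rintro rfl
    simp [hw] at hneg
  obtain ⟨x, hx⟩ : ∃ x, σ x ≠ x := by
    by_contra! h
    exact hne (Equiv.ext h)
  set c := σ.cycleOf x with hc
  have hcyc : c.IsCycle := σ.isCycle_cycleOf hx
  have hmem : c ∈ σ.cycleFactorsFinset :=
    Equiv.Perm.cycleOf_mem_cycleFactorsFinset_iff.mpr (Equiv.Perm.mem_support.mpr hx)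
  have hd : (σ * c⁻¹).Disjoint c := Equiv.Perm.disjoint_mul_inv_of_mem_cycleFactorsFinset hmem
  have hmul : σ * c⁻¹ * c = σ := inv_mul_cancel_right σ c
  -- At each point one factor is the identity and the other agrees with `σ`, so both factors are
  -- admissible.
  have hpart : ∀ e, (c e = e ∧ (σ * c⁻¹) e = σ e) ∨ (c e = σ e ∧ (σ * c⁻¹) e = e) := by
    intro e
    have h1 : (σ * c⁻¹) (c e) = σ e := by rw [← Equiv.Perm.mul_apply, hmul]
    have h2 : c ((σ * c⁻¹) e) = σ e := by
      rw [← Equiv.Perm.mul_apply, ← hd.commute.eq, hmul]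
    rcases hd e with h | h
    · rw [h] at h2; exact Or.inr ⟨h2, h⟩
    · rw [h] at h1; exact Or.inl ⟨h, h1⟩
  have hRc : ∀ e, R e (c e) := fun e => by
    rcases hpart e with h | h
    · rw [h.1]; exact hR e
    · rw [h.1]; exact hσ e
  have hRd : ∀ e, R e ((σ * c⁻¹) e) := fun e => by
    rcases hpart e with h | h
    · rw [h.2]; exact hσ e
    · rw [h.2]; exact hR e
  have hsum := sum_weight_mul_of_disjoint hw hd
  rw [hmul] at hsum
  have hcard := hd.card_support_mul
  rw [hmul] at hcard
  have hpos := hcyc.two_le_card_support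
  -- One factor has negative weight. If it is `c`, minimality leaves no support for the rest;
  -- otherwise the rest is negative with support smaller by at least two.
  by_cases hneg' : ∑ e, w e (c e) < 0
  · have := hmin c hRc hneg'
    have h0 : (σ * c⁻¹).support.card = 0 := by omega
    rw [Finset.card_eq_zero, Equiv.Perm.support_eq_empty_iff] at h0
    rw [h0, one_mul] at hmul
    rwa [hmul] at hcyc
  · have := hmin (σ * c⁻¹) hRd (by omega)
    omega

/-- Exchanging the images of two elements with equal label preserves the weight, so that it is
enough to know that permutations with pairwise distinct labels have nonnegative weight. -/
theorem sum_weight_nonneg_of_injective [DecidableEq I] {K : Type*} {R : I → I → Prop}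
    (hR : ∀ e, R e e)
    {w : I → I → ℤ} (hw : ∀ e, w e e = 0) (label : I → I → K)
    (hlabel : ∀ e f e' f', e ≠ f → R e e' → R f f' → label e e' = label f f' →
      R e f' ∧ R f e' ∧ e ≠ e' ∧ f ≠ f' ∧ w e f' + w f e' = w e e' + w f f')
    (hinj : ∀ σ : Equiv.Perm I, (∀ e, R e (σ e)) →
      Function.Injective (fun e => label e (σ e)) → 0 ≤ ∑ e, w e (σ e))
    (σ : Equiv.Perm I) (hσ : ∀ e, R e (σ e)) : 0 ≤ ∑ e, w e (σ e) := by
  by_contra! hneg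
  obtain ⟨σ, ⟨hσ, hneg⟩, hmin⟩ := exists_minimalFor_of_wellFoundedLT
    (fun σ : Equiv.Perm I => (∀ e, R e (σ e)) ∧ ∑ e, w e (σ e) < 0)
    (fun σ => σ.support.card) ⟨σ, hσ, hneg⟩
  have hmin' : ∀ τ : Equiv.Perm I, (∀ e, R e (τ e)) → ∑ e, w e (τ e) < 0 →
      σ.support.card ≤ τ.support.card := fun τ h h' => by
    rcases le_total σ.support.card τ.support.card with h'' | h''
    · exact h''
    · exact hmin ⟨h, h'⟩ h''
  obtain ⟨e, f, hef, hne⟩ : ∃ e f, label e (σ e) = label f (σ f) ∧ e ≠ f := by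
    by_contra! h
    exact absurd (hinj σ hσ fun e f hef => h e f hef) hneg.not_ge
  obtain ⟨h1, h2, he, hf, hsum⟩ := hlabel e f _ _ hne (hσ e) (hσ f) hef
  set τ : Equiv.Perm I := σ * Equiv.swap e f with hτ
  have τe : τ e = σ f := by simp [hτ]
  have τf : τ f = σ e := by simp [hτ]
  have τx : ∀ x, x ≠ e → x ≠ f → τ x = σ x := fun x hx hx' => by
    simp [hτ, Equiv.swap_apply_of_ne_of_ne hx hx']
  have hRτ : ∀ x, R x (τ x) := fun x => by
    by_cases hx : x = e
    · rw [hx, τe]; exact h1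
    by_cases hx' : x = f
    · rw [hx', τf]; exact h2
    rw [τx x hx hx']; exact hσ x
  have hWτ : ∑ x, w x (τ x) = ∑ x, w x (σ x) := by
    have hf' : f ∈ Finset.univ.erase e := Finset.mem_erase.mpr ⟨hne.symm, Finset.mem_univ _⟩
    rw [← Finset.add_sum_erase _ _ (Finset.mem_univ e), ← Finset.add_sum_erase _ _ hf',
      ← Finset.add_sum_erase _ (fun x => w x (σ x)) (Finset.mem_univ e),
      ← Finset.add_sum_erase _ (fun x => w x (σ x)) hf', τe, τf, ← add_assoc, ← add_assoc, hsum]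
    congr 1
    refine Finset.sum_congr rfl fun x hx => ?_
    rw [Finset.mem_erase, Finset.mem_erase] at hx
    rw [τx x hx.2.1 hx.1]
  -- Both exchanged points are already moved by `σ`, so `τ` is minimal too.
  have hsupp : τ.support ⊆ σ.support := fun x hx => by
    rw [Equiv.Perm.mem_support] at hx ⊢
    by_cases hxe : x = e
    · rw [hxe]; exact he.symm
    by_cases hxf : x = f
    · rw [hxf]; exact hf.symm
    rwa [τx x hxe hxf] at hx
  have hcard : τ.support.card = σ.support.card :=
    le_antisymm (Finset.card_le_card hsupp) (hmin' τ hRτ (hWτ ▸ hneg))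
  have hcσ := isCycle_of_minimal_weight hR hw hσ hneg hmin'
  have hcτ := isCycle_of_minimal_weight hR hw hRτ (hWτ ▸ hneg) (hcard ▸ hmin')
  -- The sign of a cycle depends only on its length, whereas a transposition reverses the sign.
  have hs : Equiv.Perm.sign τ = Equiv.Perm.sign σ := by rw [hcσ.sign, hcτ.sign, hcard]
  rw [hτ, Equiv.Perm.sign_mul, Equiv.Perm.sign_swap hne] at hs
  rcases Int.units_eq_one_or (Equiv.Perm.sign σ) with h | h <;> rw [h] at hs <;>
    exact absurd hs (by decide)

end Permutations

end MatchingInstance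

namespace MatchingInstance

/-! ### Popularity in terms of permutations of the matching edges -/

section Popularity

variable {A B : Type*} (G : MatchingInstance A B)

/-- An edge `f` of `M` may follow the edge `e` of `M` on an alternating walk: the edge from the
`A`-end of `e` to the `B`-end of `f` is outside `M`, unless `e = f`. -/
def Follows (M : Finset (A × B)) (e f : {e : A × B // e ∈ M}) : Prop :=
  f = e ∨ ((e.1.1, f.1.2) ∈ G.edges ∧ (e.1.1, f.1.2) ∉ M)

/-- The votes of the `A`-end of `e` and of the `B`-end of `f` for `e` and `f`, respectively,
versus the edge joining the two vertices. -/
noncomputable def stepVote (e f : A × B) : ℤ :=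
  voteOrZero (G.prefA e.1) e.2 f.2 + voteOrZero (G.prefB f.2) f.1 e.1

theorem stepVote_self (e : A × B) : G.stepVote e e = 0 := by
  simp [stepVote, voteOrZero_self]

theorem partnersA_eq (M : Finset (A × B)) (a : A) :
    partnersA M a = partnersVia (Equiv.refl (A × B)) M a := rfl

theorem partnersB_eq (M : Finset (A × B)) (b : B) :
    partnersB M b = partnersVia (Equiv.prodComm A B) M b := rfl

variable {G}

/-- A label shared by two different edges lies outside `M`, so neither edge is fixed. As the
`A`-ends of `e`, `f` and the `B`-ends of `e'`, `f'` agree, exchanging the images only regroups the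
four votes. -/
theorem label_exchange {M : Finset (A × B)} (e f e' f' : {e : A × B // e ∈ M}) (hne : e ≠ f)
    (he : G.Follows M e e') (hf : G.Follows M f f')
    (h : (e.1.1, e'.1.2) = (f.1.1, f'.1.2)) :
    G.Follows M e f' ∧ G.Follows M f e' ∧ e ≠ e' ∧ f ≠ f' ∧
      G.stepVote e.1 f'.1 + G.stepVote f.1 e'.1 =
        G.stepVote e.1 e'.1 + G.stepVote f.1 f'.1 := by
  have key : (e.1.1, e'.1.2) ∈ G.edges ∧ (e.1.1, e'.1.2) ∉ M := by
    rcases he with rfl | he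
    · rcases hf with rfl | hf
      · exact absurd (Subtype.ext h) hne
      · rw [← h] at hf
        exact absurd e'.2 hf.2
    · exact he
  have key' := key
  rw [h] at key'
  rw [Prod.mk.injEq] at h
  refine ⟨Or.inr (by rwa [← h.2]), Or.inr (by rwa [← h.1]), ?_, ?_, ?_⟩
  · rintro rfl
    exact key.2 e.2
  · rintro rfl
    exact key'.2 f.2
  · simp only [stepVote, h.1, h.2]
    ring

variable [Fintype A] [Fintype B]

theorem exists_perm_of_isPerfectMatching {M N : Finset (A × B)} (hM : G.IsPerfectMatching M)
    (hN : G.IsPerfectMatching N) :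
    ∃ σ : Equiv.Perm {e : A × B // e ∈ M}, (∀ e, G.Follows M e (σ e)) ∧
      G.delta M N = ∑ e, G.stepVote e.1 (σ e).1 := by
  obtain ⟨S, hS, hS1, hSfix, hSsum⟩ := exists_sum_setVote_eq (Equiv.refl (A × B))
    (M := M) (N := N) (fun a => (hM.2.1 a).trans (hN.2.1 a).symm) G.prefA
  obtain ⟨T, hT, hT1, hTfix, hTsum⟩ := exists_sum_setVote_eq (Equiv.prodComm A B)
    (M := M) (N := N) (fun b => (hM.2.2 b).trans (hN.2.2 b).symm) G.prefB
  let ES : {e : A × B // e ∈ M} ≃ {e : A × B // e ∈ N} := hS.equiv S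
  let ET : {e : A × B // e ∈ M} ≃ {e : A × B // e ∈ N} := hT.equiv T
  have hES : ∀ e, (ES e).1 = S e.1 := fun _ => rfl
  have hET : ∀ e, (ET e).1 = T e.1 := fun _ => rfl
  let σ : Equiv.Perm {e : A × B // e ∈ M} := ES.trans ET.symm
  have hσ : ∀ e, S e.1 = T (σ e).1 := fun e => by
    rw [← hES, ← hET]
    simp [σ]
  have hpair : ∀ e, S e.1 = (e.1.1, (σ e).1.2) := fun e =>
    Prod.ext (hS1 e.1 e.2) (by rw [hσ]; exact hT1 _ (σ e).2)
  refine ⟨σ, fun e => ?_, ?_⟩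
  · rw [Follows, ← hpair]
    have hSN : S e.1 ∈ N := hS.mapsTo e.2
    by_cases h : S e.1 ∈ M
    · left
      -- `S` fixes its own value `S e`, an edge of both `M` and `N`; injectivity then gives `S e =
      -- e`.
      have h1 : S e.1 = e.1 := hS.injOn h e.2 (hSfix _ h hSN)
      apply ET.injective
      apply Subtype.ext
      rw [hET, hET, ← hσ, h1, hTfix e.1 e.2 (h1 ▸ hSN)]
    · exact Or.inr ⟨hN.1.1 hSN, h⟩
  · have hA : ∑ a, setVote (G.prefA a) (partnersA M a) (partnersA N a) =
        ∑ e : {e : A × B // e ∈ M}, voteOrZero (G.prefA e.1.1) e.1.2 (σ e).1.2 := by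
      refine hSsum.trans ?_
      rw [← Finset.sum_coe_sort]
      refine Finset.sum_congr rfl fun e _ => ?_
      simp [hpair]
    have hB : ∑ b, setVote (G.prefB b) (partnersB M b) (partnersB N b) =
        ∑ e : {e : A × B // e ∈ M}, voteOrZero (G.prefB (σ e).1.2) (σ e).1.1 e.1.1 := by
      refine hTsum.trans ?_
      rw [← Finset.sum_coe_sort, ← Equiv.sum_comp σ]
      refine Finset.sum_congr rfl fun e _ => ?_
      simp [← hσ, hpair]
    rw [delta, hA, hB, ← Finset.sum_add_distrib]
    rfl

/-- The joining edges form `N`; distinctness makes it equinumerous with `M` at every vertex. Only an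
inequality results, since the pairings induced by `σ` need not minimize the votes. -/
theorem exists_isPerfectMatching_of_perm {M : Finset (A × B)} (hM : G.IsPerfectMatching M)
    (σ : Equiv.Perm {e : A × B // e ∈ M}) (hσ : ∀ e, G.Follows M e (σ e))
    (hinj : Function.Injective (fun e => (e.1.1, (σ e).1.2))) :
    ∃ N, G.IsPerfectMatching N ∧ G.delta M N ≤ ∑ e, G.stepVote e.1 (σ e).1 := by
  classical
  let n : {e : A × B // e ∈ M} → A × B := fun e => (e.1.1, (σ e).1.2)
  let N : Finset (A × B) := Finset.univ.image n
  have hnN : ∀ {x}, x ∈ N ↔ ∃ e, n e = x := by simp [N]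
  have hnfix : ∀ e, n e ∈ M → σ e = e := fun e h => (hσ e).resolve_right fun h' => h'.2 h
  have hnM : ∀ e, e.1 ∈ N → n e = e.1 ∧ σ e = e := by
    intro e he
    obtain ⟨f, hf⟩ := hnN.mp he
    have h1 : σ f = f := hnfix f (hf ▸ e.2)
    have h2 : f = e := Subtype.ext (by rw [← hf]; simp [n, h1])
    rw [h2] at h1 hf
    exact ⟨hf, h1⟩
  have bij : ∀ τ : Equiv.Perm {e : A × B // e ∈ M},
      Set.BijOn (fun x => if h : x ∈ M then n (τ ⟨x, h⟩) else x) M N := by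
    intro τ
    refine ⟨fun x hx => ?_, fun x hx y hy hxy => ?_, fun x hx => ?_⟩
    · rw [Finset.mem_coe] at hx
      simp only [hx, dite_true]
      exact hnN.mpr ⟨_, rfl⟩
    · rw [Finset.mem_coe] at hx hy
      simp only [hx, hy, dite_true] at hxy
      exact congrArg Subtype.val (τ.injective (hinj hxy))
    · obtain ⟨e, rfl⟩ := hnN.mp hx
      refine ⟨(τ.symm e).1, (τ.symm e).2, ?_⟩
      simp
  -- The joining edge of `e` shares its `A`-end with `e` and its `B`-end with `σ e`, hence the
  -- choices `1` and `σ⁻¹`.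
  have hA := bij 1
  have hB := bij σ⁻¹
  set S := fun x => if h : x ∈ M then n ((1 : Equiv.Perm {e : A × B // e ∈ M}) ⟨x, h⟩) else x
    with hS
  set T := fun x => if h : x ∈ M then n (σ⁻¹ ⟨x, h⟩) else x with hT
  have Sval : ∀ e : {e : A × B // e ∈ M}, S e.1 = n e := fun e => by simp [hS, e.2]
  have Tval : ∀ e : {e : A × B // e ∈ M}, T (σ e).1 = n e := fun e => by
    simp only [hT, (σ e).2, dite_true, Subtype.coe_eta, ← Equiv.Perm.mul_apply,
      inv_mul_cancel, Equiv.Perm.one_apply]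
  have S1 : ∀ e ∈ M, (Equiv.refl (A × B) (S e)).1 = (Equiv.refl (A × B) e).1 := fun e he => by
    have := Sval ⟨e, he⟩
    simp only at this
    simp [this, n]
  have T1 : ∀ e ∈ M, (Equiv.prodComm A B (T e)).1 = (Equiv.prodComm A B e).1 := fun e he => by
    obtain ⟨f, hf⟩ := σ.surjective ⟨e, he⟩
    have := Tval f
    rw [hf] at this
    simp only at this
    simp [this, n, hf]
  have Sfix : ∀ e ∈ M, e ∈ N → S e = e := fun e he heN =>
    (Sval ⟨e, he⟩).trans (hnM ⟨e, he⟩ heN).1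
  have Tfix : ∀ e ∈ M, e ∈ N → T e = e := fun e he heN => by
    have h := hnM ⟨e, he⟩ heN
    have := Tval ⟨e, he⟩
    rw [h.2, h.1] at this
    exact this
  have cA : ∀ a, (partnersA N a).card = G.capA a := fun a =>
    (card_partnersVia_eq (r := Equiv.refl (A × B)) hA S1 a).trans (hM.2.1 a)
  have cB : ∀ b, (partnersB N b).card = G.capB b := fun b =>
    (card_partnersVia_eq (r := Equiv.prodComm A B) hB T1 b).trans (hM.2.2 b)
  refine ⟨N, ⟨⟨fun x hx => ?_, fun a => (cA a).le, fun b => (cB b).le⟩, cA, cB⟩, ?_⟩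
  · obtain ⟨e, rfl⟩ := hnN.mp hx
    rcases hσ e with h | h
    · simp only [n, h]
      exact hM.1.1 e.2
    · exact h.1
  · have h1 : ∑ a, setVote (G.prefA a) (partnersA M a) (partnersA N a) ≤
        ∑ e : {e : A × B // e ∈ M}, voteOrZero (G.prefA e.1.1) e.1.2 (σ e).1.2 := by
      refine (sum_setVote_le (r := Equiv.refl (A × B)) hA S1 Sfix G.prefA).trans_eq ?_
      rw [← Finset.sum_coe_sort]
      refine Finset.sum_congr rfl fun e _ => ?_
      simp [Sval, n]
    have h2 : ∑ b, setVote (G.prefB b) (partnersB M b) (partnersB N b) ≤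
        ∑ e : {e : A × B // e ∈ M}, voteOrZero (G.prefB (σ e).1.2) (σ e).1.1 e.1.1 := by
      refine (sum_setVote_le (r := Equiv.prodComm A B) hB T1 Tfix G.prefB).trans_eq ?_
      rw [← Finset.sum_coe_sort, ← Equiv.sum_comp σ]
      refine Finset.sum_congr rfl fun e _ => ?_
      simp [Tval, n]
    refine (add_le_add h1 h2).trans_eq ?_
    rw [← Finset.sum_add_distrib]
    rfl

/-- A perfect matching is popular if and only if no permutation of its edges along alternating
walks has negative total vote. -/
theorem isPopularPerfectMatching_iff {M : Finset (A × B)} (hM : G.IsPerfectMatching M) :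
    G.IsPopularPerfectMatching M ↔ ∀ σ : Equiv.Perm {e : A × B // e ∈ M},
      (∀ e, G.Follows M e (σ e)) → 0 ≤ ∑ e, G.stepVote e.1 (σ e).1 := by
  classical
  constructor
  · intro h
    refine sum_weight_nonneg_of_injective (I := {e : A × B // e ∈ M}) (fun e => Or.inl rfl)
      (w := fun e f => G.stepVote e.1 f.1) (fun e => G.stepVote_self e.1)
      (fun e f => (e.1.1, f.1.2)) label_exchange fun σ hσ hinj => ?_
    obtain ⟨N, hN, hle⟩ := exists_isPerfectMatching_of_perm hM σ hσ hinj
    exact (h.2 N hN).trans hle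
  · refine fun h => ⟨hM, fun N hN => ?_⟩
    obtain ⟨σ, hσ, hsum⟩ := exists_perm_of_isPerfectMatching hM hN
    exact hsum ▸ h σ hσ

end Popularity

/-! ### Transfer to realizations -/

section Realizations

variable {A B : Type*} {G : MatchingInstance A B} {M : Finset (A × B)}

theorem exists_injective_clone {V U X : Type*} {cap : V → ℕ} (r : X ≃ V × U) {M : Finset X}
    (h : ∀ v, (partnersVia r M v).card = cap v) :
    ∃ i : ∀ e : {e : X // e ∈ M}, Fin (cap (r e.1).1),
      Function.Injective (fun e => (⟨(r e.1).1, i e⟩ : Σ v, Fin (cap v))) := by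
  let F : (Σ v, {u // u ∈ partnersVia r M v}) ≃ Σ v, Fin (cap v) :=
    Equiv.sigmaCongrRight fun v => Finset.equivFinOfCardEq (h v)
  have hmem : ∀ e : {e : X // e ∈ M}, (r e.1).2 ∈ partnersVia r M (r e.1).1 := fun e => by
    rw [mem_partnersVia]
    simp
  refine ⟨fun e => Finset.equivFinOfCardEq (h _) ⟨(r e.1).2, hmem e⟩, fun e f hef => ?_⟩
  have h' : F ⟨(r e.1).1, (r e.1).2, hmem e⟩ = F ⟨(r f.1).1, (r f.1).2, hmem f⟩ := hef
  have h' := congrArg (fun x : Σ v, {u // u ∈ partnersVia r M v} => (x.1, x.2.1))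
    (F.injective h')
  exact Subtype.ext (r.injective h')

/-- Counting edges by voter. It upgrades the injective assignment of clones to a bijection, so a
realization saturates all clones. -/
theorem card_eq_card_clones {V U X : Type*} [Fintype V] {cap : V → ℕ} (r : X ≃ V × U)
    {M : Finset X} (h : ∀ v, (partnersVia r M v).card = cap v) :
    Fintype.card {e : X // e ∈ M} = Fintype.card (Σ v, Fin (cap v)) := by
  have := sum_partnersVia r M fun _ _ => 1
  simp only [Finset.sum_const, nsmul_eq_mul, mul_one, h] at this
  rw [Fintype.card_coe, Fintype.card_sigma]
  simp only [Fintype.card_fin]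
  exact_mod_cast this.symm

theorem card_partnersVia_eq_one {V U X I : Type*} {r : X ≃ V × U} {M : Finset X} {E : I → X}
    (hE : ∀ x, x ∈ M ↔ ∃ e, E e = x) (hbij : Function.Bijective fun e => (r (E e)).1) (v : V) :
    (partnersVia r M v).card = 1 := by
  obtain ⟨e, rfl⟩ := hbij.2 v
  rw [Finset.card_eq_one]
  refine ⟨(r (E e)).2, Finset.ext fun u => ?_⟩
  rw [mem_partnersVia, hE, Finset.mem_singleton]
  constructor
  · rintro ⟨f, hf⟩
    rw [Equiv.eq_symm_apply] at hf
    have hfe : (r (E f)).1 = (r (E e)).1 := by rw [hf]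
    have : f = e := hbij.1 hfe
    rw [← this]
    exact (congrArg Prod.snd hf).symm
  · rintro rfl
    exact ⟨e, by simp⟩

theorem exists_isRealization (hM : G.IsPerfectMatching M) : ∃ M', G.IsRealization M M' := by
  obtain ⟨i, hi⟩ := exists_injective_clone (Equiv.refl (A × B)) hM.2.1
  obtain ⟨j, hj⟩ := exists_injective_clone (Equiv.prodComm A B) hM.2.2
  exact ⟨_, i, j, hi, hj, rfl⟩

/-- Indices only break ties between clones of the same vertex. -/
theorem voteOrZero_clonePref {V : Type*} {cap : V → ℕ} (pref : V → V → Prop)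
    {x y : Σ v : V, Fin (cap v)} (h : y.1 ≠ x.1) :
    voteOrZero (clonePref pref) x y = voteOrZero pref x.1 y.1 := by
  have h' : y ≠ x := fun e => h (congrArg Sigma.fst e)
  classical
  have h1 : clonePref pref x y ↔ pref x.1 y.1 := or_iff_left fun e => h e.1.symm
  have h2 : clonePref pref y x ↔ pref y.1 x.1 := or_iff_left fun e => h e.1
  simp only [voteOrZero, vote, if_neg h, if_neg h']
  exact if_congr h1 rfl (if_congr h2 rfl rfl)

/-- Popularity of a perfect matching can be tested on any of its realizations. -/
theorem IsRealization.isPopularPerfectMatching_iff [Fintype A] [Fintype B]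
    {M' : Finset (G.CloneA × G.CloneB)}
    (hM : G.IsPerfectMatching M) (h : G.IsRealization M M') :
    (G.realizationInstance M M').IsPopularPerfectMatching M' ↔
      G.IsPopularPerfectMatching M := by
  classical
  have hedges := G.realizationInstance_edges hM.1.1 h
  obtain ⟨i, j, hi, hj, hM'⟩ := h
  let E : {e : A × B // e ∈ M} → G.CloneA × G.CloneB := fun e => (⟨e.1.1, i e⟩, ⟨e.1.2, j e⟩)
  have hE : ∀ x, x ∈ M' ↔ ∃ e, E e = x := fun x => by
    rw [hM']
    simp [E]
  have hbi : Function.Bijective fun e => (E e).1 :=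
    (Fintype.bijective_iff_injective_and_card _).mpr
      ⟨hi, card_eq_card_clones (Equiv.refl (A × B)) hM.2.1⟩
  have hbj : Function.Bijective fun e => (E e).2 :=
    (Fintype.bijective_iff_injective_and_card _).mpr
      ⟨hj, card_eq_card_clones (Equiv.prodComm A B) hM.2.2⟩
  have cA : ∀ x, (partnersA M' x).card = 1 :=
    card_partnersVia_eq_one (r := Equiv.refl _) hE hbi
  have cB : ∀ y, (partnersB M' y).card = 1 :=
    card_partnersVia_eq_one (r := Equiv.prodComm _ _) hE hbj
  have hP : (G.realizationInstance M M').IsPerfectMatching M' := by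
    refine ⟨⟨?_, fun x => (cA x).le, fun y => (cB y).le⟩, cA, cB⟩
    rw [hedges]
    exact Finset.subset_union_left
  let ε : {e : A × B // e ∈ M} ≃ {e : G.CloneA × G.CloneB // e ∈ M'} :=
    Equiv.ofBijective (fun e => ⟨E e, (hE _).mpr ⟨e, rfl⟩⟩)
      ⟨fun e f hef => hi (congrArg (fun x => x.1.1) hef), fun x => by
        obtain ⟨e, he⟩ := (hE _).mp x.2
        exact ⟨e, Subtype.ext he⟩⟩
  have hfollows : ∀ e f, (G.realizationInstance M M').Follows M' (ε e) (ε f) ↔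
      G.Follows M e f := by
    intro e f
    rw [Follows, Follows, ε.injective.eq_iff, hedges]
    refine or_congr_right ?_
    have hval : ((ε e).1.1, (ε f).1.2) = ((E e).1, (E f).2) := rfl
    rw [hval, realizationEdges, Finset.mem_union, Finset.mem_filter, Finset.mem_sdiff]
    have hproj : ∀ x ∈ M', (x.1.1, x.2.1) ∈ M := fun x hx => by
      obtain ⟨g, rfl⟩ := (hE x).mp hx
      exact g.2
    constructor
    · rintro ⟨h1 | h1, h2⟩
      · exact absurd h1 h2
      · exact h1.2
    · exact fun h1 => ⟨Or.inr ⟨Finset.mem_univ _, h1⟩, fun h2 => h1.2 (hproj _ h2)⟩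
  have hstep : ∀ e f, G.Follows M e f →
      (G.realizationInstance M M').stepVote (ε e).1 (ε f).1 = G.stepVote e.1 f.1 := by
    rintro e f (rfl | hef)
    · rw [stepVote_self, stepVote_self]
    -- If the two edges shared an end, the edge joining them would be `e` or `f`, hence in `M`.
    · have h2 : f.1.2 ≠ e.1.2 := fun h => hef.2 (by rw [h]; exact e.2)
      have h1 : e.1.1 ≠ f.1.1 := fun h => hef.2 (by rw [h]; exact f.2)
      exact congrArg₂ (· + ·)
        (voteOrZero_clonePref (G.prefA e.1.1) (x := (E e).2) (y := (E f).2) h2)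
        (voteOrZero_clonePref (G.prefB f.1.2) (x := (E f).1) (y := (E e).1) h1)
  rw [MatchingInstance.isPopularPerfectMatching_iff hP,
    MatchingInstance.isPopularPerfectMatching_iff hM, ← ε.permCongr.forall_congr_right]
  refine forall_congr' fun σ => ?_
  have hσ : ∀ e, ε.permCongr σ (ε e) = ε (σ e) := fun e => by simp
  rw [← ε.forall_congr_right, ← Equiv.sum_comp ε]
  simp only [hσ, hfollows]
  refine imp_congr_right fun h => ?_
  rw [Finset.sum_congr rfl fun e _ => hstep e (σ e) (h e)]

end Realizations

end MatchingInstance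

theorem corollary1 {A : Type*} {B : Type*} [Fintype A] [Fintype B]
    (G : MatchingInstance A B) (M : Finset (A × B)) (hM : G.IsPerfectMatching M) :
    G.IsPopularPerfectMatching M ↔
      ∃ M' : Finset (G.CloneA × G.CloneB), G.IsRealization M M' ∧
        (G.realizationInstance M M').IsPopularPerfectMatching M' := by
  constructor
  · intro h
    obtain ⟨M', hM'⟩ := MatchingInstance.exists_isRealization hM
    exact ⟨M', hM', (hM'.isPopularPerfectMatching_iff hM).mpr h⟩
  · rintro ⟨M', hM', h⟩
    exact (hM'.isPopularPerfectMatching_iff hM).mp h
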